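/- For integers $0\le k\le n$ let $\Delta_{k,n}\subseteq\mathbb{R}^n$ be the hypersimplex, i.e. the convex hull of the indicator vectors of the $k$-element subsets of $\{1,\dots,n\}$ (the base polytope of the uniform matroid $\mathsf{U}_{k,n}$). For a polytope $\mathscr{P}$ let $f_{\mathscr{P}}(t)=\sum_{i=0}^{\dim \mathscr{P}} f_i\,t^i$, where $f_i$ is the number of $i$-dimensional faces of $\mathscr{P}$ (the empty face is not counted, $\mathscr{P}$ itself is). Put \[ \mathscr{P}(\mathsf{\Lambda}_{k-r,k,n-h,n}) := \Big\{x\in\Delta_{k,n} : \sum_{i=1}^h x_i\le r\Big\},\qquad u_{r,k,h,n}(t) := f_{\Delta_{k,n}}(t)-f_{\mathscr{P}(\mathsf{\Lambda}_{k-r,k,n-h,n})}(t), \] and, for integers $0<\alpha<a$ and $0<\beta<b$, \[ w_{\alpha,\beta,a,b}(t) := f_{\Delta_{\alpha+\beta,a+b}}(t)-f_{\Delta_{\alpha,a}}(t)\cdot f_{\Delta_{\beta,b}}(t)-u_{\alpha,\alpha+\beta,a,a+b}(t)-u_{\beta,\alpha+\beta,b,a+b}(t). \] For non-negative integers $i,j$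 with $i+j\le n$ write $\binom{n}{i,j}:=\frac{n!}{i!\,j!\,(n-i-j)!}$. **Proposition 2.5.** For any integers $0<\alpha<a$ and $0<\beta<b$, the following identity of polynomials in $t$ holds: \[ w_{\alpha,\beta,a,b}(t) = \sum_{i=0}^{a-\alpha-1} \sum_{j=0}^{\alpha-1} \sum_{i'=0}^{b-\beta-1} \sum_{j'=0}^{\beta-1} \binom{a}{i,j}\binom{b}{i',j'} \cdot (1+t) \cdot t^{a+b-i-j-i'-j'-2}. \] -/

import Mathlib

open Polynomial

noncomputable section

/-- The dimension of a set `P ⊆ ℝⁿ`: the dimension of its affine hull. -/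
def polyDim {n : ℕ} (P : Set (Fin n → ℝ)) : ℕ :=
  Module.finrank ℝ (vectorSpan ℝ P)

/-- The faces of dimension `i` of a polytope `P ⊆ ℝⁿ`. A face is a non-empty subset of `P` of the
form `{x ∈ P | l y ≤ l x for all y ∈ P}` with `l` a linear functional; `P` itself is a face
(take `l = 0`), and the empty face is not counted. -/
def facesOfDim {n : ℕ} (P : Set (Fin n → ℝ)) (i : ℕ) : Set (Set (Fin n → ℝ)) :=
  {F | F.Nonempty ∧ IsExposed ℝ P F ∧ polyDim F = i}

/-- The entry `f_i` of the `f`-vector: the number of `i`-dimensional faces of `P`. -/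
def faceNumber {n : ℕ} (P : Set (Fin n → ℝ)) (i : ℕ) : ℕ :=
  (facesOfDim P i).ncard

/-- The `f`-polynomial `f_P(t) = ∑_{i=0}^{dim P} f_i t^i`. -/
def fPoly {n : ℕ} (P : Set (Fin n → ℝ)) : ℤ[X] :=
  ∑ i ∈ Finset.range (polyDim P + 1), C (faceNumber P i : ℤ) * X ^ i

/-- The hypersimplex `Δ_{k,n} ⊆ ℝⁿ`, that is, the base polytope of the uniform matroid `U_{k,n}`:
the convex hull of the indicator vectors of the `k`-element subsets of an `n`-element set. -/
def hypersimplex (k n : ℕ) : Set (Fin n → ℝ) :=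
  convexHull ℝ {x | ∃ B : Finset (Fin n), B.card = k ∧ x = fun i => if i ∈ B then 1 else 0}

/-- The base polytope of the Schubert elementary split matroid `Λ_{k-r,k,n-h,n}`:
the points of `Δ_{k,n}` whose first `h` coordinates have sum at most `r`. -/
def schubertPolytope (r k h n : ℕ) : Set (Fin n → ℝ) :=
  {x | x ∈ hypersimplex k n ∧ ∑ i : Fin n with i.val < h, x i ≤ (r : ℝ)}

/-- `u_{r,k,h,n}(t) = f_{Δ_{k,n}}(t) - f_{P(Λ_{k-r,k,n-h,n})}(t)`. -/
def uPoly (r k h n : ℕ) : ℤ[X] :=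
  fPoly (hypersimplex k n) - fPoly (schubertPolytope r k h n)

/-- `w_{α,β,a,b}(t) = f_{Δ_{α+β,a+b}}(t) - f_{Δ_{α,a}}(t) f_{Δ_{β,b}}(t)
- u_{α,α+β,a,a+b}(t) - u_{β,α+β,b,a+b}(t)`. -/
def wPoly (α β a b : ℕ) : ℤ[X] :=
  fPoly (hypersimplex (α + β) (a + b))
    - fPoly (hypersimplex α a) * fPoly (hypersimplex β b)
    - uPoly α (α + β) a (a + b) - uPoly β (α + β) b (a + b)

/-- The multinomial coefficient `n! / (i! j! (n - i - j)!)`, for `i + j ≤ n`. -/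
def trinomCoeff (n i j : ℕ) : ℕ :=
  Nat.multinomial Finset.univ ![i, j, n - i - j]

end

/-! Expanding the definition, w is the sum of the two Schubert `f`-polynomials minus that of the
large hypersimplex and minus the product of the two small ones. Every term is a sum over pairs of
sign vectors `c₁`, `c₂`, recording which coordinates of each block are 0, 1 or strictly between: a
non-empty face of a polyhedron is determined by the constraints tight at a relative interior point,
and its direction is the space those constraints annihilate (`fPoly_eq_sum_codes`,
`fPoly_schubertPolytope`).

The identity then holds pair by pair (`ite_codes_identity`). By `realizable_iff`, the first-block
sums s compatible with a pair form an empty set, a point or an open interval, and the four polytopes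
ask whether it meets s < α, s > α, or s = α, or is non-empty. If α and β lie strictly inside the
ranges of their blocks, the cut at s = α slices a face into two pieces and a common facet, and the
net contribution is (1 + X) times a power of X; otherwise everything cancels. Counting sign vectors
by their numbers of zeros and ones (`sum_codes`) gives the trinomial coefficients. -/

/-! ### Faces of polyhedra via tight constraints -/

section Faces

variable {n : ℕ} {J : Type*} [Finite J]

/-- Slack constraints survive a small step by continuity, tight ones by the sign condition;
finiteness of `J` gives a common step size. -/
theorem exists_pos_add_smul_le (l : J → StrongDual ℝ (Fin n → ℝ)) (b : J → ℝ)
    {x v : Fin n → ℝ} (hx : ∀ j, l j x ≤ b j) (hv : ∀ j, l j x = b j → l j v ≤ 0) :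
    ∃ ε : ℝ, 0 < ε ∧ ∀ j, l j (x + ε • v) ≤ b j := by
  have h : ∀ᶠ ε in nhdsWithin (0 : ℝ) (Set.Ioi 0), ∀ j, l j (x + ε • v) ≤ b j := by
    rw [Filter.eventually_all]
    intro j
    rcases (hx j).eq_or_lt with h | h
    · filter_upwards [self_mem_nhdsWithin] with ε hε
      have := mul_nonpos_of_nonneg_of_nonpos (le_of_lt (Set.mem_Ioi.1 hε)) (hv j h)
      simp only [map_add, map_smul, smul_eq_mul]
      linarith
    · have hc : Continuous fun ε : ℝ => l j (x + ε • v) := by fun_prop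
      have h0 : l j (x + (0 : ℝ) • v) < b j := by simpa using h
      exact ((hc.tendsto 0).eventually_lt_const h0).filter_mono nhdsWithin_le_nhds |>.mono
        fun _ => le_of_lt
  obtain ⟨ε, hε, h0⟩ := (h.and self_mem_nhdsWithin).exists
  exact ⟨ε, h0, hε⟩

/-- The non-empty exposed faces of a polyhedron are the sets of points at which a realizable set
of constraints is tight. -/
theorem nonempty_isExposed_iff (l : J → StrongDual ℝ (Fin n → ℝ)) (b : J → ℝ)
    {F : Set (Fin n → ℝ)} :
    F.Nonempty ∧ IsExposed ℝ {x | ∀ j, l j x ≤ b j} F ↔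
      ∃ x, (∀ j, l j x ≤ b j) ∧
        F = {y | (∀ j, l j y ≤ b j) ∧ ∀ j, l j x = b j → l j y = b j} := by
  classical
  have := Fintype.ofFinite J
  constructor
  · rintro ⟨hne, hex⟩
    obtain ⟨f, hf⟩ := hex hne
    -- A point of `F` with the fewest tight constraints plays the role of a relative interior point.
    let tight : (Fin n → ℝ) → Finset J := fun x => {j | l j x = b j}
    obtain ⟨x, hxF, hmin⟩ : ∃ x ∈ F, ∀ y ∈ F, (tight x).card ≤ (tight y).card := by
      obtain ⟨x, hx, h⟩ := WellFounded.has_min (measure fun x => (tight x).card).wf F hne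
      exact ⟨x, hx, fun y hy => not_lt.1 (h y hy)⟩
    have hxF' := hxF
    rw [hf] at hxF'
    obtain ⟨hxP, hxmax⟩ := hxF'
    refine ⟨x, hxP, Set.Subset.antisymm ?_ ?_⟩
    · intro y hy
      have hy' := hy
      rw [hf] at hy'
      obtain ⟨hyP, hymax⟩ := hy'
      refine ⟨hyP, ?_⟩
      -- At a midpoint only constraints tight at both ends are tight, so minimality at `x` forces
      -- those tight at `x` to be tight at `y`.
      have hm : (1 / 2 : ℝ) • x + (1 / 2 : ℝ) • y ∈ F := by
        rw [hf]
        refine ⟨fun j => ?_, fun z hz => ?_⟩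
        · have h1 := hxP j
          have h2 := hyP j
          simp only [map_add, map_smul, smul_eq_mul]
          linarith
        · have h1 := hxmax z hz
          have h2 := hymax z hz
          simp only [map_add, map_smul, smul_eq_mul]
          linarith
      have hsub : tight ((1 / 2 : ℝ) • x + (1 / 2 : ℝ) • y) ⊆ tight x ∩ tight y := by
        intro j hj
        have h1 := hxP j
        have h2 := hyP j
        simp only [tight, Finset.mem_filter, Finset.mem_univ, true_and, map_add, map_smul,
          smul_eq_mul, Finset.mem_inter] at hj ⊢
        constructor <;> linarith
      have heq : tight x ∩ tight y = tight x :=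
        Finset.eq_of_subset_of_card_le Finset.inter_subset_left
          ((hmin _ hm).trans (Finset.card_le_card hsub))
      intro j hj
      have : j ∈ tight x ∩ tight y := by rw [heq]; simpa [tight] using hj
      simpa [tight] using (Finset.mem_inter.1 this).2
    · rintro y ⟨hyP, hy⟩
      -- The segment from `y` to `x` can be prolonged past `x` inside the polyhedron; maximality of
      -- `f` at `x` then rules out `f y < f x`.
      obtain ⟨ε, hε, h⟩ := exists_pos_add_smul_le l b (v := x - y) hxP (fun j hj => by
        rw [map_sub, hj, hy j hj, sub_self])
      have h1 := hxmax _ h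
      simp only [map_add, map_smul, map_sub, smul_eq_mul] at h1
      have h2 : f x ≤ f y := by
        by_contra hlt
        have := mul_pos hε (sub_pos.2 (not_le.1 hlt))
        linarith
      rw [hf]
      exact ⟨hyP, fun z hz => (hxmax z hz).trans h2⟩
  · rintro ⟨x, hxP, rfl⟩
    -- The sum of the constraints tight at `x` exposes the face: it reaches its maximum exactly
    -- where each summand does.
    refine ⟨⟨x, hxP, fun _ h => h⟩, fun _ => ⟨∑ j with l j x = b j, l j, ?_⟩⟩
    ext y
    simp only [Set.mem_ofPred_eq, sum_apply]
    refine and_congr_right fun hyP => ⟨fun h z hz => ?_, fun h => ?_⟩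
    · refine Finset.sum_le_sum fun j hj => ?_
      rw [h j (Finset.mem_filter.1 hj).2]
      exact hz j
    · have h1 := h x hxP
      have h2 : ∑ j with l j x = b j, l j y = ∑ j with l j x = b j, l j x := by
        refine le_antisymm (Finset.sum_le_sum fun j hj => ?_) h1
        rw [(Finset.mem_filter.1 hj).2]
        exact hyP j
      rw [Finset.sum_eq_sum_iff_of_le (fun j hj => by
        rw [(Finset.mem_filter.1 hj).2]; exact hyP j)] at h2
      intro j hj
      rw [h2 j (by simpa using hj), hj]

/-- The direction of a face of a polyhedron consists of the vectors annihilated by the tight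
constraints. -/
theorem vectorSpan_face (l : J → StrongDual ℝ (Fin n → ℝ)) (b : J → ℝ) {x : Fin n → ℝ}
    (hx : ∀ j, l j x ≤ b j) {V : Submodule ℝ (Fin n → ℝ)}
    (hV : ∀ v, v ∈ V ↔ ∀ j, l j x = b j → l j v = 0) :
    vectorSpan ℝ {y | (∀ j, l j y ≤ b j) ∧ ∀ j, l j x = b j → l j y = b j} = V := by
  apply le_antisymm
  · rw [vectorSpan, Submodule.span_le]
    rintro _ ⟨y, hy, z, hz, rfl⟩
    refine (hV _).2 fun j hj => ?_
    change l j (y - z) = 0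
    rw [map_sub, hy.2 j hj, hz.2 j hj, sub_self]
  · intro v hv
    rw [hV] at hv
    obtain ⟨ε, hε, h⟩ := exists_pos_add_smul_le l b (v := v) hx fun j hj => (hv j hj).le
    have h1 : (x + ε • v) -ᵥ x ∈
        vectorSpan ℝ {y | (∀ j, l j y ≤ b j) ∧ ∀ j, l j x = b j → l j y = b j} := by
      refine vsub_mem_vectorSpan ℝ ⟨h, fun j hj => ?_⟩ ⟨hx, fun _ h => h⟩
      rw [map_add, map_smul, hv j hj, hj, smul_zero, add_zero]
    have h2 := Submodule.smul_mem _ ε⁻¹ h1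
    simpa [smul_smul, hε.ne'] using h2

open Classical in
/-- The `f`-polynomial of a polyhedron as a sum over the realizable sets of tight constraints,
each of which is encoded by an element of `κ`. -/
theorem fPoly_eq_sum_codes {κ : Type*} [Fintype κ] (l : J → StrongDual ℝ (Fin n → ℝ)) (b : J → ℝ)
    {P : Set (Fin n → ℝ)} (hP : P = {x | ∀ j, l j x ≤ b j}) (code : (Fin n → ℝ) → κ)
    (hcode : ∀ x ∈ P, ∀ y ∈ P, code x = code y ↔ ∀ j, l j x = b j ↔ l j y = b j) (d : κ → ℕ)
    (V : κ → Submodule ℝ (Fin n → ℝ)) (hd : ∀ c, Module.finrank ℝ (V c) = d c)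
    (hV : ∀ x ∈ P, ∀ v, v ∈ V (code x) ↔ ∀ j, l j x = b j → l j v = 0) :
    fPoly P = ∑ c with ∃ x ∈ P, code x = c, X ^ d c := by
  have hface : ∀ x ∈ P, vectorSpan ℝ
      {y | (∀ j, l j y ≤ b j) ∧ ∀ j, l j x = b j → l j y = b j} = V (code x) := by
    intro x hx
    have hx' := hx
    rw [hP] at hx'
    exact vectorSpan_face l b hx' (hV x hx)
  have hle : ∀ c ∈ Finset.univ.filter (fun c => ∃ x ∈ P, code x = c),
      d c ∈ Finset.range (polyDim P + 1) := by
    intro c hc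
    obtain ⟨x, hx, rfl⟩ := (Finset.mem_filter.1 hc).2
    rw [Finset.mem_range, Nat.lt_succ_iff, ← hd, ← hface x hx, polyDim]
    refine Submodule.finrank_mono (vectorSpan_mono ℝ ?_)
    rw [hP]
    exact fun y hy => hy.1
  rw [fPoly, ← Finset.sum_fiberwise_of_maps_to hle]
  refine Finset.sum_congr rfl fun i _ => ?_
  rw [Finset.sum_congr rfl (g := fun _ => (X : ℤ[X]) ^ i)
    (fun c hc => by rw [(Finset.mem_filter.1 hc).2]), Finset.sum_const, nsmul_eq_mul]
  congr 1
  rw [faceNumber, map_natCast, Nat.cast_inj]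
  -- The face belonging to a code, phrased with an existential so that it is defined on all of `κ`;
  -- by `hcode` the choice of point is immaterial.
  let g : κ → Set (Fin n → ℝ) := fun c =>
    {y | y ∈ P ∧ ∃ x ∈ P, code x = c ∧ ∀ j, l j x = b j → l j y = b j}
  have hg : ∀ x ∈ P, g (code x) =
      {y | (∀ j, l j y ≤ b j) ∧ ∀ j, l j x = b j → l j y = b j} := by
    intro x hx
    ext y
    constructor
    · rintro ⟨hy, x', hx', hc, h⟩
      rw [hP] at hy
      exact ⟨hy, fun j hj => h j (((hcode _ hx' _ hx).1 hc j).2 hj)⟩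
    · rintro ⟨hy, h⟩
      exact ⟨by rw [hP]; exact hy, x, hx, rfl, h⟩
  have hinj : Set.InjOn g {c | (∃ x ∈ P, code x = c) ∧ d c = i} := by
    rintro _ ⟨⟨x, hx, rfl⟩, -⟩ _ ⟨⟨y, hy, rfl⟩, -⟩ h
    have hx' := hx
    have hy' := hy
    rw [hP] at hx' hy'
    rw [hg x hx, hg y hy] at h
    rw [hcode x hx y hy]
    have h1 : x ∈ {z | (∀ j, l j z ≤ b j) ∧ ∀ j, l j y = b j → l j z = b j} := by
      rw [← h]; exact ⟨hx', fun _ h => h⟩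
    have h2 : y ∈ {z | (∀ j, l j z ≤ b j) ∧ ∀ j, l j x = b j → l j z = b j} := by
      rw [h]; exact ⟨hy', fun _ h => h⟩
    exact fun j => ⟨h2.2 j, h1.2 j⟩
  have himg : facesOfDim P i = g '' {c | (∃ x ∈ P, code x = c) ∧ d c = i} := by
    ext F
    have key := nonempty_isExposed_iff l b (F := F)
    rw [← hP] at key
    rw [facesOfDim, Set.mem_ofPred_eq, ← and_assoc, key]
    constructor
    · rintro ⟨⟨x, hx, rfl⟩, hdim⟩
      have hx' : x ∈ P := by rw [hP]; exact hx
      refine ⟨code x, ⟨⟨x, hx', rfl⟩, ?_⟩, hg x hx'⟩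
      rw [← hdim, polyDim, hface x hx', hd]
    · rintro ⟨_, ⟨⟨x, hx, rfl⟩, hdim⟩, rfl⟩
      have hx' := hx
      rw [hP] at hx'
      refine ⟨⟨x, hx', hg x hx⟩, ?_⟩
      rw [hg x hx, polyDim, hface x hx, hd, hdim]
  rw [himg, hinj.ncard_image, ← Set.ncard_coe_finset]
  congr 1
  ext c
  simp

end Faces

/-! ### Inequality description of the hypersimplex -/

section Hypersimplex

theorem exists_natCast_eq_sum {ι : Type*} (s : Finset ι) (x : ι → ℝ)
    (h : ∀ i ∈ s, x i = 0 ∨ x i = 1) : ∃ m : ℕ, ∑ i ∈ s, x i = m := by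
  classical
  refine ⟨(s.filter fun i => x i = 1).card, ?_⟩
  rw [Finset.card_filter, Nat.cast_sum]
  refine Finset.sum_congr rfl fun i hi => ?_
  rcases h i hi with h | h <;> simp [h]

/-- Since the total is an integer, a fractional coordinate cannot be the only one. Moving a small
amount back and forth between two of them shows `x` as a midpoint. -/
theorem eq_zero_or_one_of_mem_extremePoints {n k : ℕ} {x : Fin n → ℝ}
    (hx : x ∈ Set.extremePoints ℝ {x : Fin n → ℝ | (∀ i, 0 ≤ x i ∧ x i ≤ 1) ∧ ∑ i, x i = (k : ℝ)})
    (p : Fin n) : x p = 0 ∨ x p = 1 := by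
  by_contra! hp
  obtain ⟨⟨hbox, hsum⟩, hext⟩ := hx
  have hp0 : 0 < x p := lt_of_le_of_ne (hbox p).1 hp.1.symm
  have hp1 : x p < 1 := lt_of_le_of_ne (hbox p).2 hp.2
  obtain ⟨q, hqp, hq⟩ : ∃ q, q ≠ p ∧ x q ≠ 0 ∧ x q ≠ 1 := by
    by_contra! h
    obtain ⟨m, hm⟩ := exists_natCast_eq_sum (Finset.univ.erase p) x fun i hi => by
      by_cases h0 : x i = 0
      · exact Or.inl h0
      · exact Or.inr (h i (Finset.ne_of_mem_erase hi) h0)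
    have h1 := Finset.add_sum_erase Finset.univ x (Finset.mem_univ p)
    rw [hm, hsum] at h1
    have h2 : (m : ℝ) < k := by linarith
    have h3 : (k : ℝ) < m + 1 := by linarith
    have h4 : m < k := by exact_mod_cast h2
    have h5 : k < m + 1 := by exact_mod_cast h3
    omega
  have hq0 : 0 < x q := lt_of_le_of_ne (hbox q).1 hq.1.symm
  have hq1 : x q < 1 := lt_of_le_of_ne (hbox q).2 hq.2
  obtain ⟨ε, hε, h1, h2, h3, h4⟩ : ∃ ε, 0 < ε ∧ ε ≤ x p ∧ ε ≤ 1 - x p ∧ ε ≤ x q ∧ ε ≤ 1 - x q :=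
    ⟨min (min (x p) (1 - x p)) (min (x q) (1 - x q)),
      lt_min (lt_min hp0 (sub_pos.2 hp1)) (lt_min hq0 (sub_pos.2 hq1)),
      (min_le_left _ _).trans (min_le_left _ _), (min_le_left _ _).trans (min_le_right _ _),
      (min_le_right _ _).trans (min_le_left _ _), (min_le_right _ _).trans (min_le_right _ _)⟩
  have hmem : ∀ δ : ℝ, |δ| ≤ ε → x + (Pi.single p δ - Pi.single q δ) ∈
      {x : Fin n → ℝ | (∀ i, 0 ≤ x i ∧ x i ≤ 1) ∧ ∑ i, x i = (k : ℝ)} := by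
    intro δ hδ
    obtain ⟨hδ1, hδ2⟩ := abs_le.1 hδ
    refine ⟨fun i => ?_, ?_⟩
    · by_cases hip : i = p
      · subst hip
        simp only [Pi.add_apply, Pi.sub_apply, Pi.single_eq_same, Pi.single_eq_of_ne hqp.symm]
        constructor <;> linarith
      · by_cases hiq : i = q
        · subst hiq
          simp only [Pi.add_apply, Pi.sub_apply, Pi.single_eq_same, Pi.single_eq_of_ne hip]
          constructor <;> linarith
        · simpa [Pi.single_eq_of_ne hip, Pi.single_eq_of_ne hiq] using hbox i
    · simp [Finset.sum_add_distrib, Finset.sum_sub_distrib, hsum]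
  have h := hext (hmem ε (abs_of_pos hε).le) (hmem (-ε) (by rw [abs_neg, abs_of_pos hε]))
    ⟨1 / 2, 1 / 2, by norm_num, by norm_num, by norm_num, by
      ext i
      simp only [Pi.single_neg, Pi.add_apply, Pi.smul_apply, Pi.sub_apply, Pi.neg_apply,
        smul_eq_mul]
      ring⟩
  have := congrFun h p
  simp only [Pi.add_apply, Pi.sub_apply, Pi.single_eq_same, Pi.single_eq_of_ne hqp.symm] at this
  linarith

/-- The hypersimplex is the slice of the unit cube at which the coordinates add up to `k`. -/
theorem hypersimplex_eq (k n : ℕ) :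
    hypersimplex k n = {x | (∀ i, 0 ≤ x i ∧ x i ≤ 1) ∧ ∑ i, x i = (k : ℝ)} := by
  have hconv : Convex ℝ {x : Fin n → ℝ | (∀ i, 0 ≤ x i ∧ x i ≤ 1) ∧ ∑ i, x i = (k : ℝ)} := by
    rintro x ⟨hx, hxs⟩ y ⟨hy, hys⟩ s t hs ht hst
    refine ⟨fun i => ?_, ?_⟩
    · simp only [Pi.add_apply, Pi.smul_apply, smul_eq_mul]
      constructor
      · have := mul_nonneg hs (hx i).1
        have := mul_nonneg ht (hy i).1
        linarith
      · have := mul_le_mul_of_nonneg_left (hx i).2 hs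
        have := mul_le_mul_of_nonneg_left (hy i).2 ht
        linarith
    · simp only [Pi.add_apply, Pi.smul_apply, smul_eq_mul, Finset.sum_add_distrib,
        ← Finset.mul_sum, hxs, hys, ← add_mul, hst, one_mul]
  have hcomp : IsCompact {x : Fin n → ℝ | (∀ i, 0 ≤ x i ∧ x i ≤ 1) ∧ ∑ i, x i = (k : ℝ)} := by
    have h : {x : Fin n → ℝ | (∀ i, 0 ≤ x i ∧ x i ≤ 1) ∧ ∑ i, x i = (k : ℝ)} =
        Set.Icc 0 1 ∩ {x | ∑ i, x i = (k : ℝ)} := by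
      ext x
      simp [Pi.le_def, forall_and]
    rw [h]
    exact isCompact_Icc.inter_right (isClosed_eq (by fun_prop) continuous_const)
  apply Set.Subset.antisymm
  · refine convexHull_min ?_ hconv
    rintro _ ⟨B, hB, rfl⟩
    refine ⟨fun i => ?_, by simp [hB]⟩
    by_cases h : i ∈ B <;> simp [h]
  · have hfin : Set.Finite
        {x | ∃ B : Finset (Fin n), B.card = k ∧ x = fun i => if i ∈ B then (1 : ℝ) else 0} :=
      (Set.finite_range fun (B : Finset (Fin n)) i => if i ∈ B then (1 : ℝ) else 0).subset
        fun x ⟨B, _, hx⟩ => ⟨B, hx.symm⟩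
    -- Krein–Milman; the hull of finitely many points is closed, so both sides can be compared as
    -- closures.
    rw [← closure_convexHull_extremePoints hcomp hconv, hypersimplex,
      ← (hfin.isClosed_convexHull (𝕜 := ℝ)).closure_eq]
    refine closure_mono (convexHull_mono fun x hx => ?_)
    have h01 := eq_zero_or_one_of_mem_extremePoints hx
    have hx' : x = fun i => if i ∈ Finset.univ.filter (fun i => x i = 1) then (1 : ℝ) else 0 := by
      ext i
      rcases h01 i with h | h <;> simp [h]
    refine ⟨Finset.univ.filter fun i => x i = 1, ?_, hx'⟩
    have hs := hx.1.2
    rw [hx'] at hs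
    simpa using hs

/-- With bound `k + 1` the extra inequality is never tight, so face counts of hypersimplices become
a special case of those of Schubert polytopes. -/
theorem schubertPolytope_succ (k h n : ℕ) : schubertPolytope (k + 1) k h n = hypersimplex k n := by
  ext x
  refine ⟨fun hx => hx.1, fun hx => ⟨hx, ?_⟩⟩
  rw [hypersimplex_eq] at hx
  have h1 : ∑ i : Fin n with i.val < h, x i ≤ ∑ i, x i :=
    Finset.sum_le_sum_of_subset_of_nonneg (Finset.filter_subset _ _) fun i _ _ => (hx.1 i).1
  rw [hx.2] at h1
  push_cast
  linarith

end Hypersimplex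

/-! ### Dimensions of face directions -/

section Dimension

/-- The vectors with coordinate sum zero that are supported on the zero coordinates of `c`. -/
def zeroSumOn {ι : Type*} [Fintype ι] (c : ι → SignType) : Submodule ℝ (ι → ℝ) where
  carrier := {v | (∀ i, c i ≠ 0 → v i = 0) ∧ ∑ i, v i = 0}
  add_mem' := by
    rintro v w ⟨hv, hv'⟩ ⟨hw, hw'⟩
    exact ⟨fun i hi => by simp [hv i hi, hw i hi], by simp [Finset.sum_add_distrib, hv', hw']⟩
  zero_mem' := by simp
  smul_mem' := by
    rintro r v ⟨hv, hv'⟩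
    exact ⟨fun i hi => by simp [hv i hi], by simp [← Finset.mul_sum, hv']⟩

theorem mem_zeroSumOn {ι : Type*} [Fintype ι] {c : ι → SignType} {v : ι → ℝ} :
    v ∈ zeroSumOn c ↔ (∀ i, c i ≠ 0 → v i = 0) ∧ ∑ i, v i = 0 := Iff.rfl

/-- The number of zero entries of a sign vector. -/
def freeCard {ι : Type*} [Fintype ι] (c : ι → SignType) : ℕ :=
  (Finset.univ.filter fun i => c i = 0).card

theorem finrank_ker_sum (T : Type*) [Fintype T] :
    Module.finrank ℝ (LinearMap.ker (∑ i : T, LinearMap.proj (R := ℝ) (φ := fun _ => ℝ) i)) =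
      Fintype.card T - 1 := by
  classical
  rcases isEmpty_or_nonempty T with h | ⟨⟨i⟩⟩
  · rw [Fintype.card_eq_zero]
    exact Module.finrank_zero_of_subsingleton
  · have hne : (∑ i : T, LinearMap.proj (R := ℝ) (φ := fun _ => ℝ) i) ≠ 0 := by
      intro h
      have := LinearMap.congr_fun h (Pi.single i 1)
      simp [LinearMap.sum_apply] at this
    have := Module.Dual.finrank_ker_add_one_of_ne_zero (K := ℝ) hne
    rw [Module.finrank_fintype_fun_eq_card] at this
    omega

/-- Extension by zero identifies this space with the kernel of the coordinate sum on the free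
coordinates. With no free coordinate both sides are 0, which is where truncated subtraction matters.
-/
theorem finrank_zeroSumOn {ι : Type*} [Fintype ι] (c : ι → SignType) :
    Module.finrank ℝ (zeroSumOn c) = freeCard c - 1 := by
  classical
  have hinj : Function.Injective
      (Function.ExtendByZero.linearMap ℝ (Subtype.val : {i // c i = 0} → ι)) :=
    Function.extend_injective Subtype.val_injective _
  have hZ : zeroSumOn c = (LinearMap.ker
      (∑ i : {i // c i = 0}, LinearMap.proj (R := ℝ) (φ := fun _ => ℝ) i)).map
        (Function.ExtendByZero.linearMap ℝ Subtype.val) := by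
    have hsum : ∀ v : ι → ℝ, (∀ i, c i ≠ 0 → v i = 0) →
        ∑ i : {i // c i = 0}, v i = ∑ i, v i := by
      intro v hv
      rw [← Finset.sum_subtype (Finset.univ.filter fun i => c i = 0) (by simp) v]
      exact Finset.sum_subset (Finset.subset_univ _) fun i _ hi => hv i (by simpa using hi)
    ext v
    rw [mem_zeroSumOn, Submodule.mem_map]
    constructor
    · rintro ⟨hv, hs⟩
      refine ⟨fun i => v i, by simpa [LinearMap.sum_apply, hsum v hv] using hs, ?_⟩
      ext i
      rw [Function.ExtendByZero.linearMap_apply]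
      by_cases hi : c i = 0
      · exact Subtype.val_injective.extend_apply _ _ (⟨i, hi⟩ : {i // c i = 0})
      · rw [Function.extend_apply' _ _ _ (by rintro ⟨⟨j, hj⟩, rfl⟩; exact hi hj), hv i hi]
        rfl
    · rintro ⟨u, hu, rfl⟩
      have hz : ∀ i, c i ≠ 0 →
          Function.ExtendByZero.linearMap ℝ (Subtype.val : {i // c i = 0} → ι) u i = 0 := by
        intro i hi
        rw [Function.ExtendByZero.linearMap_apply,
          Function.extend_apply' _ _ _ (by rintro ⟨⟨j, hj⟩, rfl⟩; exact hi hj)]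
        rfl
      refine ⟨hz, ?_⟩
      rw [← hsum _ hz]
      simpa [LinearMap.sum_apply, Function.ExtendByZero.linearMap_apply,
        Subtype.val_injective.extend_apply] using hu
  rw [hZ, ← (Submodule.equivMapOfInjective _ hinj _).finrank_eq, finrank_ker_sum, freeCard,
    Fintype.card_subtype]

theorem freeCard_sumElim {p q : Type*} [Fintype p] [Fintype q] (c₁ : p → SignType)
    (c₂ : q → SignType) : freeCard (Sum.elim c₁ c₂) = freeCard c₁ + freeCard c₂ := by
  simp only [freeCard, Finset.card_filter, Fintype.sum_sum_type, Sum.elim_inl, Sum.elim_inr]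
  rfl

theorem finrank_submodule_prod {M N : Type*} [AddCommGroup M] [AddCommGroup N] [Module ℝ M]
    [Module ℝ N] [FiniteDimensional ℝ M] [FiniteDimensional ℝ N] (V : Submodule ℝ M)
    (W : Submodule ℝ N) :
    Module.finrank ℝ (V.prod W) = Module.finrank ℝ V + Module.finrank ℝ W := by
  have h : V.prod W = LinearMap.range (V.subtype.prodMap W.subtype) := by
    rw [LinearMap.range_prodMap, Submodule.range_subtype, Submodule.range_subtype]
  rw [h, LinearMap.finrank_range_of_inj, Module.finrank_prod]
  exact V.subtype_injective.prodMap W.subtype_injective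

end Dimension

/-! ### Encoding faces of Schubert polytopes by sign vectors -/

section Codes

open Classical in
/-- The position of each coordinate in the unit interval: `-1` at the left end point, `1` at the
right end point, and `0` in between. -/
noncomputable def coordCode {ι : Type*} (x : ι → ℝ) : ι → SignType := fun i =>
  if x i = 0 then -1 else if x i = 1 then 1 else 0

theorem coordCode_eq_neg_one {ι : Type*} {x : ι → ℝ} {i : ι} : coordCode x i = -1 ↔ x i = 0 := by
  unfold coordCode
  split_ifs <;> simp_all

theorem coordCode_eq_one {ι : Type*} {x : ι → ℝ} {i : ι} : coordCode x i = 1 ↔ x i = 1 := by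
  unfold coordCode
  split_ifs <;> simp_all

theorem coordCode_ne_zero {ι : Type*} {x : ι → ℝ} {i : ι} :
    coordCode x i ≠ 0 ↔ x i = 0 ∨ x i = 1 := by
  unfold coordCode
  split_ifs <;> simp_all

theorem coordCode_eq_iff {ι : Type*} {x y : ι → ℝ} :
    coordCode x = coordCode y ↔ ∀ i, (x i = 0 ↔ y i = 0) ∧ (x i = 1 ↔ y i = 1) := by
  constructor
  · intro h i
    rw [← coordCode_eq_neg_one, ← coordCode_eq_neg_one, ← coordCode_eq_one, ← coordCode_eq_one, h]
    exact ⟨Iff.rfl, Iff.rfl⟩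
  · intro h
    ext i
    simp only [coordCode, (h i).1, (h i).2]

/-- The code `c` is the code of a point of the unit cube with coordinate sum `s`. -/
def Realizable {ι : Type*} [Fintype ι] (c : ι → SignType) (s : ℝ) : Prop :=
  ∃ y : ι → ℝ, (∀ i, 0 ≤ y i ∧ y i ≤ 1) ∧ coordCode y = c ∧ ∑ i, y i = s

variable {n : ℕ} {p q : Type*} [Fintype p] [Fintype q]

/-- The direction of the face of a Schubert polytope with given code. -/
noncomputable def codeDirection (e : Fin n ≃ p ⊕ q) (c : ((p → SignType) × (q → SignType)) × Bool) :
    Submodule ℝ (Fin n → ℝ) :=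
  -- When the cut is tight, the two block sums vanish separately and the direction splits as a
  -- product.
  if c.2 then
    ((zeroSumOn c.1.1).prod (zeroSumOn c.1.2)).map
      ((LinearEquiv.funCongrLeft ℝ ℝ e.symm).trans
        (LinearEquiv.sumArrowLequivProdArrow p q ℝ ℝ)).symm.toLinearMap
  else (zeroSumOn (Sum.elim c.1.1 c.1.2)).map
      (LinearEquiv.funCongrLeft ℝ ℝ e.symm).symm.toLinearMap

theorem mem_codeDirection (e : Fin n ≃ p ⊕ q) (c : ((p → SignType) × (q → SignType)) × Bool)
    (v : Fin n → ℝ) : v ∈ codeDirection e c ↔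
      (∀ i, c.1.1 i ≠ 0 → v (e.symm (.inl i)) = 0) ∧ (∀ i, c.1.2 i ≠ 0 → v (e.symm (.inr i)) = 0) ∧
      ∑ i, v (e.symm (.inl i)) + ∑ i, v (e.symm (.inr i)) = 0 ∧
      (c.2 = true → ∑ i, v (e.symm (.inl i)) = 0) := by
  obtain ⟨⟨c₁, c₂⟩, t⟩ := c
  cases t
  · simp [codeDirection, Submodule.mem_map_equiv, mem_zeroSumOn, Sum.forall,
      Fintype.sum_sum_type, LinearEquiv.funCongrLeft_apply, LinearMap.funLeft_apply, and_assoc]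
  · simp only [codeDirection, if_true, Submodule.mem_map_equiv, LinearEquiv.symm_symm,
      Submodule.mem_prod, mem_zeroSumOn, LinearEquiv.trans_apply,
      LinearEquiv.sumArrowLequivProdArrow_apply_fst, LinearEquiv.sumArrowLequivProdArrow_apply_snd,
      LinearEquiv.funCongrLeft_apply, LinearMap.funLeft_apply]
    constructor
    · rintro ⟨⟨h1, h2⟩, h3, h4⟩
      exact ⟨h1, h3, by rw [h2, h4, add_zero], fun _ => h2⟩
    · rintro ⟨h1, h3, h2, h4⟩
      have h5 := h4 trivial
      rw [h5, zero_add] at h2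
      exact ⟨⟨h1, h5⟩, h3, h2⟩

theorem finrank_codeDirection (e : Fin n ≃ p ⊕ q)
    (c : ((p → SignType) × (q → SignType)) × Bool) :
    Module.finrank ℝ (codeDirection e c) =
      if c.2 then (freeCard c.1.1 - 1) + (freeCard c.1.2 - 1)
      else freeCard c.1.1 + freeCard c.1.2 - 1 := by
  obtain ⟨⟨c₁, c₂⟩, t⟩ := c
  cases t
  · exact (LinearEquiv.finrank_map_eq (LinearEquiv.funCongrLeft ℝ ℝ e.symm).symm _).trans
      (by rw [finrank_zeroSumOn, freeCard_sumElim]; rfl)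
  · exact (LinearEquiv.finrank_map_eq ((LinearEquiv.funCongrLeft ℝ ℝ e.symm).trans
      (LinearEquiv.sumArrowLequivProdArrow p q ℝ ℝ)).symm _).trans
      (by rw [finrank_submodule_prod, finrank_zeroSumOn, finrank_zeroSumOn]; rfl)

/-- The constraints that define a Schubert polytope. -/
noncomputable def schubertConstraint (h n : ℕ) :
    (Fin n ⊕ Fin n) ⊕ (Bool ⊕ Unit) → StrongDual ℝ (Fin n → ℝ)
  | .inl (.inl i) => -ContinuousLinearMap.proj i
  | .inl (.inr i) => ContinuousLinearMap.proj i
  | .inr (.inl true) => ∑ i, ContinuousLinearMap.proj i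
  | .inr (.inl false) => -∑ i, ContinuousLinearMap.proj i
  | .inr (.inr _) => ∑ i : Fin n with i.val < h, ContinuousLinearMap.proj i

/-- The right-hand sides of the constraints that define a Schubert polytope. -/
def schubertBound (r k n : ℕ) : (Fin n ⊕ Fin n) ⊕ (Bool ⊕ Unit) → ℝ
  | .inl (.inl _) => 0
  | .inl (.inr _) => 1
  | .inr (.inl true) => k
  | .inr (.inl false) => -k
  | .inr (.inr _) => r

theorem mem_schubertPolytope {r k h : ℕ} {x : Fin n → ℝ} : x ∈ schubertPolytope r k h n ↔
    ((∀ i, 0 ≤ x i ∧ x i ≤ 1) ∧ ∑ i, x i = k) ∧ ∑ i : Fin n with i.val < h, x i ≤ r := by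
  rw [schubertPolytope, Set.mem_ofPred_eq, hypersimplex_eq, Set.mem_ofPred_eq]

theorem schubertPolytope_eq (r k h n : ℕ) : schubertPolytope r k h n =
    {x | ∀ j, schubertConstraint h n j x ≤ schubertBound r k n j} := by
  ext x
  rw [mem_schubertPolytope, Set.mem_ofPred_eq]
  simp only [Sum.forall, Bool.forall_bool, schubertConstraint, schubertBound,
    neg_apply, ContinuousLinearMap.proj_apply, sum_apply, forall_and,
    neg_nonpos, neg_le_neg_iff, forall_const, le_antisymm_iff]
  tauto

theorem sum_eq_sum_add_sum (e : Fin n ≃ p ⊕ q) (x : Fin n → ℝ) :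
    ∑ i, x i = ∑ i, x (e.symm (.inl i)) + ∑ i, x (e.symm (.inr i)) := by
  rw [← Equiv.sum_comp e.symm, Fintype.sum_sum_type]

theorem sum_filter_lt_eq_sum {h : ℕ} (e : Fin n ≃ p ⊕ q) (he : ∀ i, (e i).isLeft ↔ i.val < h)
    (x : Fin n → ℝ) : ∑ i : Fin n with i.val < h, x i = ∑ i, x (e.symm (.inl i)) := by
  have h1 : ∀ i : p, (e.symm (.inl i)).val < h := fun i => by simp [← he]
  have h2 : ∀ i : q, ¬ (e.symm (.inr i)).val < h := fun i => by simp [← he]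
  rw [Finset.sum_filter, sum_eq_sum_add_sum e]
  simp [h1, h2]

/-- The two inequalities expressing the total sum are tight everywhere and carry no information,
which leaves the box constraints and the cut. -/
theorem tight_congr {r k h : ℕ} (e : Fin n ≃ p ⊕ q) (he : ∀ i, (e i).isLeft ↔ i.val < h)
    {x y : Fin n → ℝ} (hx : x ∈ schubertPolytope r k h n) (hy : y ∈ schubertPolytope r k h n) :
    (∀ j, schubertConstraint h n j x = schubertBound r k n j ↔
      schubertConstraint h n j y = schubertBound r k n j) ↔
    (∀ i, (x i = 0 ↔ y i = 0) ∧ (x i = 1 ↔ y i = 1)) ∧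
      (∑ i, x (e.symm (.inl i)) = r ↔ ∑ i, y (e.symm (.inl i)) = r) := by
  rw [mem_schubertPolytope] at hx hy
  simp only [Sum.forall, Bool.forall_bool, schubertConstraint, schubertBound,
    neg_apply, ContinuousLinearMap.proj_apply, sum_apply, forall_and,
    neg_eq_zero, forall_const, hx.1.2, hy.1.2, sum_filter_lt_eq_sum e he]
  tauto

theorem tight_imp {r k h : ℕ} (e : Fin n ≃ p ⊕ q) (he : ∀ i, (e i).isLeft ↔ i.val < h)
    {x : Fin n → ℝ} (hx : x ∈ schubertPolytope r k h n) (v : Fin n → ℝ) :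
    (∀ j, schubertConstraint h n j x = schubertBound r k n j → schubertConstraint h n j v = 0) ↔
    (∀ i, x i = 0 ∨ x i = 1 → v i = 0) ∧
      ∑ i, v (e.symm (.inl i)) + ∑ i, v (e.symm (.inr i)) = 0 ∧
      (∑ i, x (e.symm (.inl i)) = r → ∑ i, v (e.symm (.inl i)) = 0) := by
  rw [mem_schubertPolytope] at hx
  simp only [Sum.forall, Bool.forall_bool, schubertConstraint, schubertBound,
    neg_apply, ContinuousLinearMap.proj_apply, sum_apply, forall_and,
    neg_eq_zero, forall_const, hx.1.2, sum_filter_lt_eq_sum e he, or_imp,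
    ← sum_eq_sum_add_sum e]
  tauto

open Classical in
/-- The `f`-polynomial of a Schubert polytope as a sum over codes of points. -/
theorem fPoly_schubertPolytope [DecidableEq p] [DecidableEq q] {h : ℕ} (r k : ℕ) (e : Fin n ≃ p ⊕ q)
    (he : ∀ i, (e i).isLeft ↔ i.val < h) :
    fPoly (schubertPolytope r k h n) = ∑ c : (p → SignType) × (q → SignType),
      ((if ∃ s : ℝ, s < r ∧ Realizable c.1 s ∧ Realizable c.2 (k - s) then
          X ^ (freeCard c.1 + freeCard c.2 - 1) else 0) +
        (if Realizable c.1 r ∧ Realizable c.2 (k - r) then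
          X ^ ((freeCard c.1 - 1) + (freeCard c.2 - 1)) else 0)) := by
  let code : (Fin n → ℝ) → ((p → SignType) × (q → SignType)) × Bool := fun x =>
    ((coordCode fun i => x (e.symm (.inl i)), coordCode fun i => x (e.symm (.inr i))),
      decide (∑ i, x (e.symm (.inl i)) = r))
  rw [fPoly_eq_sum_codes (schubertConstraint h n) (schubertBound r k n)
    (schubertPolytope_eq r k h n) code ?_ _ (codeDirection e) (finrank_codeDirection e) ?_]
  · rw [Finset.sum_filter, Fintype.sum_prod_type]
    refine Finset.sum_congr rfl fun c _ => ?_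
    rw [Fintype.sum_bool, add_comm]
    -- The blocks interact only through their sums, so realizability reduces to a choice of the
    -- first sum `s`.
    have hglue : ∀ (y : p → ℝ) (z : q → ℝ), ∃ x : Fin n → ℝ,
        (fun i => x (e.symm (.inl i))) = y ∧ (fun i => x (e.symm (.inr i))) = z :=
      fun y z => ⟨fun i => Sum.elim y z (e i), by simp, by simp⟩
    have hbox : ∀ x : Fin n → ℝ, (∀ i, 0 ≤ x i ∧ x i ≤ 1) ↔
        (∀ i, 0 ≤ x (e.symm (.inl i)) ∧ x (e.symm (.inl i)) ≤ 1) ∧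
        (∀ i, 0 ≤ x (e.symm (.inr i)) ∧ x (e.symm (.inr i)) ≤ 1) := fun x => by
      rw [← e.symm.forall_congr_right (q := fun i => 0 ≤ x i ∧ x i ≤ 1), Sum.forall]
    congr 1
    · refine if_congr ?_ (by simp) rfl
      constructor
      · rintro ⟨x, hx, hc⟩
        rw [mem_schubertPolytope, sum_eq_sum_add_sum e, sum_filter_lt_eq_sum e he, hbox] at hx
        simp only [code, Prod.ext_iff, decide_eq_false_iff_not] at hc
        exact ⟨_, lt_of_le_of_ne hx.2 hc.2, ⟨_, hx.1.1.1, hc.1.1, rfl⟩,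
          ⟨_, hx.1.1.2, hc.1.2, eq_sub_of_add_eq' hx.1.2⟩⟩
      · rintro ⟨s, hs, ⟨y, hy, hyc, hys⟩, z, hz, hzc, hzs⟩
        obtain ⟨x, rfl, rfl⟩ := hglue y z
        refine ⟨x, ?_, ?_⟩
        · rw [mem_schubertPolytope, sum_eq_sum_add_sum e, sum_filter_lt_eq_sum e he, hbox]
          exact ⟨⟨⟨hy, hz⟩, by rw [hys, hzs]; ring⟩, by rw [hys]; exact hs.le⟩
        · simp only [code, Prod.ext_iff, decide_eq_false_iff_not]
          exact ⟨⟨hyc, hzc⟩, by rw [hys]; exact hs.ne⟩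
    · refine if_congr ?_ (by simp) rfl
      constructor
      · rintro ⟨x, hx, hc⟩
        rw [mem_schubertPolytope, sum_eq_sum_add_sum e, sum_filter_lt_eq_sum e he, hbox] at hx
        simp only [code, Prod.ext_iff, decide_eq_true_eq] at hc
        refine ⟨⟨_, hx.1.1.1, hc.1.1, hc.2⟩,
          ⟨_, hx.1.1.2, hc.1.2, eq_sub_of_add_eq' ?_⟩⟩
        rw [← hx.1.2, hc.2]
      · rintro ⟨⟨y, hy, hyc, hys⟩, z, hz, hzc, hzs⟩
        obtain ⟨x, rfl, rfl⟩ := hglue y z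
        refine ⟨x, ?_, ?_⟩
        · rw [mem_schubertPolytope, sum_eq_sum_add_sum e, sum_filter_lt_eq_sum e he, hbox]
          exact ⟨⟨⟨hy, hz⟩, by rw [hys, hzs]; ring⟩, hys.le⟩
        · simp only [code, Prod.ext_iff, decide_eq_true_eq]
          exact ⟨⟨hyc, hzc⟩, hys⟩
  · intro x hx y hy
    rw [tight_congr e he hx hy, ← e.symm.forall_congr_right
      (q := fun i => (x i = 0 ↔ y i = 0) ∧ (x i = 1 ↔ y i = 1)), Sum.forall]
    simp only [code, Prod.ext_iff, coordCode_eq_iff, decide_eq_decide]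
  · intro x hx v
    rw [tight_imp e he hx, mem_codeDirection, ← e.symm.forall_congr_right
      (q := fun i => x i = 0 ∨ x i = 1 → v i = 0), Sum.forall]
    simp only [code, coordCode_ne_zero, decide_eq_true_eq]
    tauto

end Codes

/-! ### Possible coordinate sums of a sign vector -/

section Realizability

variable {ι : Type*} [Fintype ι]

/-- The number of entries of a code that are equal to `-1`: the coordinates equal to zero. -/
def zeroCard (c : ι → SignType) : ℕ :=
  (Finset.univ.filter fun i => c i = -1).card

/-- The number of entries of a code that are equal to `1`: the coordinates equal to one. -/
def oneCard (c : ι → SignType) : ℕ :=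
  (Finset.univ.filter fun i => c i = 1).card

theorem zeroCard_add_oneCard_add_freeCard (c : ι → SignType) :
    zeroCard c + oneCard c + freeCard c = Fintype.card ι := by
  simp only [zeroCard, oneCard, freeCard, Finset.card_filter, ← Finset.sum_add_distrib]
  rw [← Finset.card_univ, Finset.card_eq_sum_ones]
  refine Finset.sum_congr rfl fun i _ => ?_
  rcases c i <;> decide

theorem sum_eq_oneCard_add (c : ι → SignType) (y : ι → ℝ) (h0 : ∀ i, c i = -1 → y i = 0)
    (h1 : ∀ i, c i = 1 → y i = 1) :
    ∑ i, y i = oneCard c + ∑ i with c i = 0, y i := by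
  rw [oneCard, Finset.card_filter, Nat.cast_sum, Finset.sum_filter, ← Finset.sum_add_distrib]
  refine Finset.sum_congr rfl fun i _ => ?_
  rcases h : c i with _ | _ | _
  · simp
  · simp [h0 i h]
  · simp [h1 i h]

/-- Each free coordinate ranges over the open unit interval. For the converse, all free coordinates
take the same value. -/
theorem realizable_iff (c : ι → SignType) (s : ℝ) :
    Realizable c s ↔ (freeCard c = 0 ∧ s = oneCard c) ∨
      (0 < freeCard c ∧ (oneCard c : ℝ) < s ∧ s < oneCard c + freeCard c) := by
  constructor
  · rintro ⟨y, hy, rfl, rfl⟩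
    rw [sum_eq_oneCard_add (coordCode y) y (fun i => coordCode_eq_neg_one.1)
      (fun i => coordCode_eq_one.1)]
    have hpos : ∀ i ∈ Finset.univ.filter (fun i => coordCode y i = 0), 0 < y i ∧ y i < 1 := by
      intro i hi
      have h := not_or.1 (mt coordCode_ne_zero.2 (not_not.2 (Finset.mem_filter.1 hi).2))
      exact ⟨lt_of_le_of_ne (hy i).1 (Ne.symm h.1), lt_of_le_of_ne (hy i).2 h.2⟩
    rcases Nat.eq_zero_or_pos (freeCard (coordCode y)) with h | h
    · left
      refine ⟨h, ?_⟩
      rw [freeCard, Finset.card_eq_zero] at h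
      rw [h, Finset.sum_empty, add_zero]
    · right
      have hne := Finset.card_pos.1 h
      refine ⟨h, lt_add_of_pos_right _ (Finset.sum_pos (fun i hi => (hpos i hi).1) hne), ?_⟩
      rw [freeCard, Finset.card_eq_sum_ones, Nat.cast_sum]
      simp only [Nat.cast_one]
      have := Finset.sum_lt_sum_of_nonempty hne fun i hi => (hpos i hi).2
      linarith
  · intro h
    let t : ℝ := (s - oneCard c) / freeCard c
    let y : ι → ℝ := fun i => if c i = 1 then 1 else if c i = 0 then t else 0
    have ht : ∀ i, c i = 0 → 0 < t ∧ t < 1 := by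
      intro i hi
      have hf : 0 < freeCard c := Finset.card_pos.2 ⟨i, by simpa using hi⟩
      rcases h with ⟨h, -⟩ | ⟨-, h1, h2⟩
      · omega
      · have hf' : (0 : ℝ) < freeCard c := by exact_mod_cast hf
        exact ⟨div_pos (by linarith) hf', (div_lt_one hf').2 (by linarith)⟩
    have hcase : ∀ i, (c i = 0 ∧ y i = t) ∨ (c i = -1 ∧ y i = 0) ∨ (c i = 1 ∧ y i = 1) := by
      intro i
      rcases h : c i with _ | _ | _ <;> simp [y, h]
    refine ⟨y, fun i => ?_, ?_, ?_⟩
    · rcases hcase i with ⟨h, h'⟩ | ⟨-, h'⟩ | ⟨-, h'⟩ <;> rw [h']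
      · exact ⟨(ht i h).1.le, (ht i h).2.le⟩
      · norm_num
      · norm_num
    · ext i
      rcases hcase i with ⟨h, h'⟩ | ⟨h, h'⟩ | ⟨h, h'⟩
      · rw [h]
        simp [coordCode, h', (ht i h).1.ne', (ht i h).2.ne]
      · rw [h, coordCode_eq_neg_one, h']
      · rw [h, coordCode_eq_one, h']
    · rw [sum_eq_oneCard_add c y (fun i hi => by simp [y, hi]) (fun i hi => by simp [y, hi]),
        Finset.sum_congr rfl (g := fun _ => t) fun i hi => by
          simp [y, (Finset.mem_filter.1 hi).2], Finset.sum_const, nsmul_eq_mul]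
      change (oneCard c : ℝ) + freeCard c * ((s - oneCard c) / freeCard c) = s
      rcases h with ⟨h, h'⟩ | ⟨h, -⟩
      · simp [h, h']
      · have : (freeCard c : ℝ) ≠ 0 := by exact_mod_cast h.ne'
        field_simp
        ring

theorem Realizable.nonneg {c : ι → SignType} {s : ℝ} (h : Realizable c s) : 0 ≤ s := by
  obtain ⟨y, hy, -, rfl⟩ := h
  exact Finset.sum_nonneg fun i _ => (hy i).1

theorem realizable_of_isEmpty [IsEmpty ι] (c : ι → SignType) (s : ℝ) :
    Realizable c s ↔ s = 0 := by
  rw [realizable_iff]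
  simp [freeCard, oneCard]

end Realizability

/-! ### Face polynomials of hypersimplices -/

section Hypersimplex

open Classical in
theorem fPoly_hypersimplex_blocks {n : ℕ} {p q : Type*} [Fintype p] [Fintype q]
    [DecidableEq p] [DecidableEq q] {h : ℕ} (k : ℕ)
    (e : Fin n ≃ p ⊕ q) (he : ∀ i, (e i).isLeft ↔ i.val < h) :
    fPoly (hypersimplex k n) = ∑ c : (p → SignType) × (q → SignType),
      (if ∃ s : ℝ, Realizable c.1 s ∧ Realizable c.2 (k - s) then
          X ^ (freeCard c.1 + freeCard c.2 - 1) else 0) := by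
  rw [← schubertPolytope_succ k h n, fPoly_schubertPolytope (k + 1) k e he]
  refine Finset.sum_congr rfl fun c _ => ?_
  rw [if_neg (c := Realizable c.1 _ ∧ _), add_zero]
  · refine if_congr ⟨fun ⟨s, _, hs⟩ => ⟨s, hs⟩, fun ⟨s, hs⟩ => ⟨s, ?_, hs⟩⟩ rfl rfl
    have := hs.2.nonneg
    push_cast
    linarith
  -- A tight cut would leave sum -1 for the second block.
  · rintro ⟨-, h⟩
    have := h.nonneg
    push_cast at this
    linarith

open Classical in
theorem fPoly_hypersimplex (k n : ℕ) : fPoly (hypersimplex k n) = ∑ c : Fin n → SignType,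
    (if Realizable c k then X ^ (freeCard c - 1) else 0) := by
  -- The second block is taken empty, which forces its sum to be 0.
  rw [fPoly_hypersimplex_blocks (h := n) k (Equiv.sumEmpty (Fin n) Empty).symm (by simp),
    Fintype.sum_prod_type]
  refine Finset.sum_congr rfl fun c _ => ?_
  rw [Fintype.sum_unique]
  refine if_congr ?_ (by simp [freeCard]) rfl
  simp only [realizable_of_isEmpty, sub_eq_zero]
  exact ⟨fun ⟨s, h, h'⟩ => h' ▸ h, fun h => ⟨_, h, rfl⟩⟩

end Hypersimplex

/-! ### Counting sign vectors -/

section Counting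

/-- Choose the positions of -1, then those of 1 in the complement. -/
theorem card_codes {n i j : ℕ} (hij : i + j ≤ n) :
    (Finset.univ.filter fun c : Fin n → SignType => zeroCard c = i ∧ oneCard c = j).card =
      trinomCoeff n i j := by
  have hcard : (Finset.univ.filter fun c : Fin n → SignType =>
      zeroCard c = i ∧ oneCard c = j).card =
      ((Finset.powersetCard i (Finset.univ : Finset (Fin n))).sigma
        fun s => Finset.powersetCard j sᶜ).card := by
    refine Finset.card_nbij'
      (fun c => ⟨Finset.univ.filter fun x => c x = -1, Finset.univ.filter fun x => c x = 1⟩)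
      (fun st x => if x ∈ st.1 then -1 else if x ∈ st.2 then 1 else 0) ?_ ?_ ?_ ?_
    · intro c hc
      have hc := (Finset.mem_filter.1 hc).2
      simp only [SetLike.mem_coe, Finset.mem_sigma, Finset.mem_powersetCard]
      refine ⟨⟨Finset.subset_univ _, hc.1⟩, fun x hx => ?_, hc.2⟩
      simp only [Finset.mem_filter, Finset.mem_univ, true_and, Finset.mem_compl] at hx ⊢
      rw [hx]
      decide
    · rintro ⟨s, t⟩ hst
      simp only [SetLike.mem_coe, Finset.mem_sigma, Finset.mem_powersetCard] at hst
      obtain ⟨⟨-, hs⟩, ht, ht'⟩ := hst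
      refine Finset.mem_coe.2 (Finset.mem_filter.2 ⟨Finset.mem_univ _, ?_, ?_⟩)
      · rw [zeroCard, ← hs]
        congr 1
        ext x
        by_cases h1 : x ∈ s <;> by_cases h2 : x ∈ t <;> simp [h1, h2]
      · rw [oneCard, ← ht']
        congr 1
        ext x
        have := @ht x
        rw [Finset.mem_compl] at this
        by_cases h1 : x ∈ s <;> by_cases h2 : x ∈ t <;> simp_all
    · intro c _
      ext x
      rcases h : c x with _ | _ | _ <;> simp [h]
    · rintro ⟨s, t⟩ hst
      simp only [SetLike.mem_coe, Finset.mem_sigma, Finset.mem_powersetCard] at hst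
      obtain ⟨-, ht, -⟩ := hst
      have h1 : (Finset.univ.filter fun x =>
          (if x ∈ s then (-1 : SignType) else if x ∈ t then 1 else 0) = -1) = s := by
        ext x
        by_cases h1 : x ∈ s <;> by_cases h2 : x ∈ t <;> simp [h1, h2]
      have h2 : (Finset.univ.filter fun x =>
          (if x ∈ s then (-1 : SignType) else if x ∈ t then 1 else 0) = 1) = t := by
        ext x
        have := @ht x
        rw [Finset.mem_compl] at this
        by_cases h1 : x ∈ s <;> by_cases h2 : x ∈ t <;> simp_all
      simp only [h1, h2]
  rw [hcard, Finset.card_sigma, Finset.sum_congr rfl (g := fun _ => (n - i).choose j)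
    fun s hs => by
      rw [Finset.card_powersetCard, Finset.card_compl, Fintype.card_fin,
        (Finset.mem_powersetCard.1 hs).2],
    Finset.sum_const, Finset.card_powersetCard, Finset.card_univ, Fintype.card_fin, smul_eq_mul,
    trinomCoeff, Nat.multinomial]
  simp only [Fin.sum_univ_three, Fin.prod_univ_three, Matrix.cons_val]
  rw [show i + j + (n - i - j) = n by omega]
  refine (Nat.div_eq_of_eq_mul_left (by positivity) ?_).symm
  rw [← Nat.choose_mul_factorial_mul_factorial (show i ≤ n by omega),
    ← Nat.choose_mul_factorial_mul_factorial (show j ≤ n - i by omega)]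
  ring

theorem sum_codes {R : Type*} [CommRing R] {n u v : ℕ} (huv : u + v ≤ n + 1) (F : ℕ → ℕ → R) :
    ∑ c : Fin n → SignType,
      (if zeroCard c < u ∧ oneCard c < v then F (zeroCard c) (oneCard c) else 0) =
    ∑ i ∈ Finset.range u, ∑ j ∈ Finset.range v, (trinomCoeff n i j : R) * F i j := by
  rw [← Finset.sum_filter, ← Finset.sum_product',
    ← Finset.sum_fiberwise_of_maps_to (g := fun c => (zeroCard c, oneCard c))
      (t := Finset.range u ×ˢ Finset.range v) (by simp)]
  refine Finset.sum_congr rfl fun ij hij => ?_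
  obtain ⟨i, j⟩ := ij
  rw [Finset.mem_product, Finset.mem_range, Finset.mem_range] at hij
  rw [Finset.sum_congr rfl (g := fun _ => F i j) fun c hc => by
    have := (Finset.mem_filter.1 hc).2
    rw [Prod.mk.injEq] at this
    rw [this.1, this.2], Finset.sum_const, nsmul_eq_mul, ← card_codes (by omega)]
  congr 3
  ext c
  simp only [Finset.mem_filter, Finset.mem_univ, true_and, Prod.mk.injEq]
  refine ⟨And.right, fun h => ⟨?_, h⟩⟩
  rw [h.1, h.2]
  exact hij

end Counting

/-! ### Cancellation for each pair of codes -/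

section Main

/-- The end points of the range are integers, so strict containment of `γ` leaves a margin of 1 on
both sides. -/
theorem realizable_of_lt {ι : Type*} [Fintype ι] {c : ι → SignType} {γ : ℕ} (h1 : oneCard c < γ)
    (h2 : γ < oneCard c + freeCard c) {s : ℝ} (h3 : (γ : ℝ) - 1 < s) (h4 : s < γ + 1) :
    Realizable c s := by
  have h1' : (oneCard c : ℝ) + 1 ≤ γ := by exact_mod_cast h1
  have h2' : (γ : ℝ) + 1 ≤ oneCard c + freeCard c := by exact_mod_cast h2
  exact (realizable_iff c s).2 (Or.inr ⟨by omega, by linarith, by linarith⟩)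

open Classical in
/-- The contribution of a single pair of codes to `wPoly`. -/
theorem ite_codes_identity {p q : Type*} [Fintype p] [Fintype q] (α β : ℕ) (c₁ : p → SignType)
    (c₂ : q → SignType) :
    ((if ∃ s : ℝ, s < α ∧ Realizable c₁ s ∧ Realizable c₂ ((α + β : ℕ) - s) then
        (X : ℤ[X]) ^ (freeCard c₁ + freeCard c₂ - 1) else 0) +
      (if Realizable c₁ α ∧ Realizable c₂ ((α + β : ℕ) - α) then
        X ^ ((freeCard c₁ - 1) + (freeCard c₂ - 1)) else 0)) +
    ((if ∃ s : ℝ, s < β ∧ Realizable c₂ s ∧ Realizable c₁ ((α + β : ℕ) - s) then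
        X ^ (freeCard c₂ + freeCard c₁ - 1) else 0) +
      (if Realizable c₂ β ∧ Realizable c₁ ((α + β : ℕ) - β) then
        X ^ ((freeCard c₂ - 1) + (freeCard c₁ - 1)) else 0)) -
    (if ∃ s : ℝ, Realizable c₁ s ∧ Realizable c₂ ((α + β : ℕ) - s) then
        X ^ (freeCard c₁ + freeCard c₂ - 1) else 0) -
    (if Realizable c₁ α then X ^ (freeCard c₁ - 1) else 0) *
      (if Realizable c₂ β then X ^ (freeCard c₂ - 1) else 0) =
    if (oneCard c₁ < α ∧ α < oneCard c₁ + freeCard c₁) ∧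
        (oneCard c₂ < β ∧ β < oneCard c₂ + freeCard c₂) then
      (1 + X) * X ^ (freeCard c₁ + freeCard c₂ - 2) else 0 := by
  have e1 : ((α + β : ℕ) : ℝ) - α = β := by push_cast; ring
  have e2 : ((α + β : ℕ) : ℝ) - β = α := by push_cast; ring
  have hprod : (if Realizable c₁ α then (X : ℤ[X]) ^ (freeCard c₁ - 1) else 0) *
      (if Realizable c₂ β then X ^ (freeCard c₂ - 1) else 0) =
      if Realizable c₁ α ∧ Realizable c₂ β then X ^ ((freeCard c₁ - 1) + (freeCard c₂ - 1))
        else 0 := by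
    by_cases h1 : Realizable c₁ α <;> by_cases h2 : Realizable c₂ β <;> simp [h1, h2, pow_add]
  -- The substitution s ↦ α + β - s turns the second Schubert polytope into the other side of the
  -- same cut.
  have hplus : (∃ s : ℝ, s < β ∧ Realizable c₂ s ∧ Realizable c₁ ((α + β : ℕ) - s)) ↔
      ∃ s : ℝ, α < s ∧ Realizable c₁ s ∧ Realizable c₂ ((α + β : ℕ) - s) := by
    constructor <;> rintro ⟨s, hs, h1, h2⟩ <;>
      exact ⟨(α + β : ℕ) - s, by push_cast; linarith, h2, by rwa [sub_sub_cancel]⟩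
  have hany : (∃ s : ℝ, Realizable c₁ s ∧ Realizable c₂ ((α + β : ℕ) - s)) ↔
      (∃ s : ℝ, s < α ∧ Realizable c₁ s ∧ Realizable c₂ ((α + β : ℕ) - s)) ∨
      (Realizable c₁ α ∧ Realizable c₂ β) ∨
      ∃ s : ℝ, α < s ∧ Realizable c₁ s ∧ Realizable c₂ ((α + β : ℕ) - s) := by
    constructor
    · rintro ⟨s, h1, h2⟩
      rcases lt_trichotomy s α with h | h | h
      · exact Or.inl ⟨s, h, h1, h2⟩
      · subst h
        exact Or.inr (Or.inl ⟨h1, by rwa [e1] at h2⟩)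
      · exact Or.inr (Or.inr ⟨s, h, h1, h2⟩)
    · rintro (⟨s, -, h⟩ | ⟨h1, h2⟩ | ⟨s, -, h⟩)
      · exact ⟨s, h⟩
      · exact ⟨α, h1, by rwa [e1]⟩
      · exact ⟨s, h⟩
  rw [hprod, e1, e2, hplus, hany, add_comm (freeCard c₂), add_comm (freeCard c₂ - 1)]
  simp only [and_comm (a := Realizable c₂ β) (b := Realizable c₁ α)]
  by_cases hG : (oneCard c₁ < α ∧ α < oneCard c₁ + freeCard c₁) ∧
        (oneCard c₂ < β ∧ β < oneCard c₂ + freeCard c₂)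
  · have hm : ∃ s : ℝ, s < α ∧ Realizable c₁ s ∧ Realizable c₂ ((α + β : ℕ) - s) := by
      refine ⟨α - 1 / 2, by linarith, realizable_of_lt hG.1.1 hG.1.2 (by linarith) (by linarith),
        realizable_of_lt hG.2.1 hG.2.2 ?_ ?_⟩ <;> push_cast <;> linarith
    have hp : ∃ s : ℝ, α < s ∧ Realizable c₁ s ∧ Realizable c₂ ((α + β : ℕ) - s) := by
      refine ⟨α + 1 / 2, by linarith, realizable_of_lt hG.1.1 hG.1.2 (by linarith) (by linarith),
        realizable_of_lt hG.2.1 hG.2.2 ?_ ?_⟩ <;> push_cast <;> linarith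
    have h0 : Realizable c₁ α ∧ Realizable c₂ β :=
      ⟨realizable_of_lt hG.1.1 hG.1.2 (by linarith) (by linarith),
        realizable_of_lt hG.2.1 hG.2.2 (by linarith) (by linarith)⟩
    -- All indicators are 1. Strictness makes both free counts at least 2, so no subtraction
    -- truncates.
    rw [if_pos hm, if_pos h0, if_pos hp, if_pos (Or.inl hm), if_pos hG,
      show freeCard c₁ + freeCard c₂ - 1 = freeCard c₁ + freeCard c₂ - 2 + 1 by omega,
      show freeCard c₁ - 1 + (freeCard c₂ - 1) = freeCard c₁ + freeCard c₂ - 2 by omega]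
    ring
  · rw [if_neg hG]
    have hdegenerate : Realizable c₁ α → Realizable c₂ β → freeCard c₁ = 0 ∨ freeCard c₂ = 0 := by
      intro h1 h2
      by_contra! h
      rcases (realizable_iff _ _).1 h1 with h1 | ⟨-, h1, h1'⟩
      · exact h.1 h1.1
      rcases (realizable_iff _ _).1 h2 with h2 | ⟨-, h2, h2'⟩
      · exact h.2 h2.1
      exact hG ⟨⟨by exact_mod_cast h1, by exact_mod_cast h1'⟩, by exact_mod_cast h2,
        by exact_mod_cast h2'⟩
    by_cases h0 : Realizable c₁ α ∧ Realizable c₂ β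
    -- A block without free coordinates has a fixed sum, so the face lies inside the cut; the
    -- exponents with separate and joint truncation then agree (`hd`) and the terms cancel.
    · have hsum : ∀ s : ℝ, Realizable c₁ s → Realizable c₂ ((α + β : ℕ) - s) → s = α := by
        intro s h1 h2
        rcases hdegenerate h0.1 h0.2 with hf | hf
        · have h3 := (realizable_iff _ _).1 h1
          have h4 := (realizable_iff _ _).1 h0.1
          simp only [hf, lt_irrefl, false_and, or_false, true_and] at h3 h4
          rw [h3, h4]
        · have h3 := (realizable_iff _ _).1 h2
          have h4 := (realizable_iff _ _).1 h0.2
          simp only [hf, lt_irrefl, false_and, or_false, true_and] at h3 h4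
          push_cast at h3
          linarith
      have hm : ¬ ∃ s : ℝ, s < α ∧ Realizable c₁ s ∧ Realizable c₂ ((α + β : ℕ) - s) :=
        fun ⟨s, hs, h1, h2⟩ => hs.ne (hsum s h1 h2)
      have hp : ¬ ∃ s : ℝ, α < s ∧ Realizable c₁ s ∧ Realizable c₂ ((α + β : ℕ) - s) :=
        fun ⟨s, hs, h1, h2⟩ => hs.ne' (hsum s h1 h2)
      have hd : freeCard c₁ - 1 + (freeCard c₂ - 1) = freeCard c₁ + freeCard c₂ - 1 := by
        rcases hdegenerate h0.1 h0.2 with hf | hf <;> omega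
      rw [if_neg hm, if_neg hp, if_pos h0, if_pos (Or.inr (Or.inl h0)), hd]
      ring
    -- Sums on both sides of α would put α and β strictly inside their ranges, against `hG`; hence
    -- the face lies on at most one side.
    · have hmp : (∃ s : ℝ, s < α ∧ Realizable c₁ s ∧ Realizable c₂ ((α + β : ℕ) - s)) →
          ¬ ∃ s : ℝ, α < s ∧ Realizable c₁ s ∧ Realizable c₂ ((α + β : ℕ) - s) := by
        rintro ⟨s, hs, h1, h2⟩ ⟨s', hs', h1', h2'⟩
        apply hG
        rw [realizable_iff] at h1 h2 h1' h2'
        push_cast at h2 h2'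
        have k1 : 0 < freeCard c₁ ∧ (oneCard c₁ : ℝ) < α ∧ (α : ℝ) < oneCard c₁ + freeCard c₁ := by
          rcases h1 with ⟨h1, e⟩ | ⟨h1, e, e'⟩ <;> rcases h1' with ⟨h1', f⟩ | ⟨h1', f, f'⟩
          · linarith
          · omega
          · omega
          · exact ⟨h1, by linarith, by linarith⟩
        have k2 : 0 < freeCard c₂ ∧ (oneCard c₂ : ℝ) < β ∧ (β : ℝ) < oneCard c₂ + freeCard c₂ := by
          rcases h2 with ⟨h1, e⟩ | ⟨h1, e, e'⟩ <;> rcases h2' with ⟨h1', f⟩ | ⟨h1', f, f'⟩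
          · linarith
          · omega
          · omega
          · exact ⟨h1, by linarith, by linarith⟩
        exact ⟨⟨by exact_mod_cast k1.2.1, by exact_mod_cast k1.2.2⟩,
          by exact_mod_cast k2.2.1, by exact_mod_cast k2.2.2⟩
      by_cases hm : ∃ s : ℝ, s < α ∧ Realizable c₁ s ∧ Realizable c₂ ((α + β : ℕ) - s)
      · rw [if_pos hm, if_neg h0, if_neg (hmp hm), if_pos (Or.inl hm)]
        ring
      · rw [if_neg hm, if_neg h0]
        simp only [hm, h0, false_or]
        ring

theorem isLeft_finSumFinEquiv_symm {a b : ℕ} (i : Fin (a + b)) :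
    ((finSumFinEquiv (m := a) (n := b)).symm i).isLeft ↔ i.val < a := by
  obtain ⟨j, rfl⟩ := finSumFinEquiv.surjective i
  rcases j with j | j <;> simp

open Classical in
theorem wPoly_eq_sum_codes (α β a b : ℕ) : wPoly α β a b =
    ∑ c : (Fin a → SignType) × (Fin b → SignType),
      if (oneCard c.1 < α ∧ α < oneCard c.1 + freeCard c.1) ∧
          (oneCard c.2 < β ∧ β < oneCard c.2 + freeCard c.2) then
        (1 + X) * X ^ (freeCard c.1 + freeCard c.2 - 2) else 0 := by
  have hswap : fPoly (schubertPolytope β (α + β) b (a + b)) =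
      ∑ c : (Fin a → SignType) × (Fin b → SignType),
        ((if ∃ s : ℝ, s < β ∧ Realizable c.2 s ∧ Realizable c.1 ((α + β : ℕ) - s) then
            X ^ (freeCard c.2 + freeCard c.1 - 1) else 0) +
          (if Realizable c.2 β ∧ Realizable c.1 ((α + β : ℕ) - β) then
            X ^ ((freeCard c.2 - 1) + (freeCard c.1 - 1)) else 0)) := by
    -- Here the first `b` coordinates form the first block; exchanging the components of each pair
    -- restores the common index set.
    rw [fPoly_schubertPolytope β (α + β) ((finCongr (add_comm a b)).trans finSumFinEquiv.symm)
        (fun i => by simpa using isLeft_finSumFinEquiv_symm (finCongr (add_comm a b) i)),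
      ← Equiv.sum_comp (Equiv.prodComm (Fin a → SignType) (Fin b → SignType))]
    rfl
  have hprod : fPoly (hypersimplex α a) * fPoly (hypersimplex β b) =
      ∑ c : (Fin a → SignType) × (Fin b → SignType),
        (if Realizable c.1 α then X ^ (freeCard c.1 - 1) else 0) *
          (if Realizable c.2 β then X ^ (freeCard c.2 - 1) else 0) := by
    rw [fPoly_hypersimplex, fPoly_hypersimplex, Finset.sum_mul_sum, Fintype.sum_prod_type]
  rw [← Finset.sum_congr rfl fun c _ => ite_codes_identity α β c.1 c.2, Finset.sum_sub_distrib,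
    Finset.sum_sub_distrib, Finset.sum_add_distrib, ← hswap,
    ← fPoly_schubertPolytope α (α + β) finSumFinEquiv.symm isLeft_finSumFinEquiv_symm,
    ← fPoly_hypersimplex_blocks (α + β) finSumFinEquiv.symm isLeft_finSumFinEquiv_symm,
    ← hprod, wPoly, uPoly, uPoly]
  ring

end Main

theorem proposition2p5 (α β a b : ℕ) (hα : 0 < α) (hαa : α < a) (hβ : 0 < β) (hβb : β < b) :
    wPoly α β a b =
      ∑ i ∈ Finset.range (a - α), ∑ j ∈ Finset.range α,
        ∑ i' ∈ Finset.range (b - β), ∑ j' ∈ Finset.range β,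
          C ((trinomCoeff a i j : ℤ) * (trinomCoeff b i' j' : ℤ)) * (1 + X)
            * X ^ (a + b - i - j - i' - j' - 2) := by
  classical
  -- Zeros, ones and free entries add up to `n`, so the upper bound on γ becomes a bound on the
  -- number of zeros.
  have key : ∀ {n γ : ℕ}, γ < n → ∀ c : Fin n → SignType,
      (oneCard c < γ ∧ γ < oneCard c + freeCard c) ↔ (zeroCard c < n - γ ∧ oneCard c < γ) := by
    intro n γ h c
    have := zeroCard_add_oneCard_add_freeCard c
    rw [Fintype.card_fin] at this
    omega
  have hinner : ∀ i j : ℕ, ∑ c : Fin b → SignType,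
      (if zeroCard c < b - β ∧ oneCard c < β then
        (1 + X : ℤ[X]) * X ^ (a + b - i - j - zeroCard c - oneCard c - 2) else 0) = _ := fun i j =>
    sum_codes (by omega) fun i' j' => (1 + X : ℤ[X]) * X ^ (a + b - i - j - i' - j' - 2)
  have houter := sum_codes (n := a) (u := a - α) (v := α) (by omega) fun i j =>
    ∑ i' ∈ Finset.range (b - β), ∑ j' ∈ Finset.range β, (trinomCoeff b i' j' : ℤ[X]) *
      ((1 + X : ℤ[X]) * X ^ (a + b - i - j - i' - j' - 2))
  rw [wPoly_eq_sum_codes, Fintype.sum_prod_type]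
  trans ∑ c : Fin a → SignType, if zeroCard c < a - α ∧ oneCard c < α then
    ∑ i' ∈ Finset.range (b - β), ∑ j' ∈ Finset.range β, (trinomCoeff b i' j' : ℤ[X]) *
      ((1 + X : ℤ[X]) * X ^ (a + b - zeroCard c - oneCard c - i' - j' - 2)) else 0
  · refine Finset.sum_congr rfl fun c _ => ?_
    simp only [key hαa, key hβb]
    split_ifs with hc
    · rw [← hinner]
      refine Finset.sum_congr rfl fun c' _ => ?_
      simp only [hc, true_and]
      have h1 := zeroCard_add_oneCard_add_freeCard c
      have h2 := zeroCard_add_oneCard_add_freeCard c'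
      rw [Fintype.card_fin] at h1 h2
      rw [show freeCard c + freeCard c' - 2 =
        a + b - zeroCard c - oneCard c - zeroCard c' - oneCard c' - 2 by omega]
    · simp [hc]
  · rw [houter]
    refine Finset.sum_congr rfl fun i _ => Finset.sum_congr rfl fun j _ => ?_
    rw [Finset.mul_sum]
    refine Finset.sum_congr rfl fun i' _ => ?_
    rw [Finset.mul_sum]
    refine Finset.sum_congr rfl fun j' _ => ?_
    simp only [map_mul, map_natCast]
    ring
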